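/- Let $T\ge 1$, $0<\varepsilon<1$, and let $\nu$ be a finite measure on $[\varepsilon,1]$ with $\nu([\varepsilon,1))>0$. Let $\beta\in\mathbb{R}^T$ and, for each $n\in\mathbb{N}$, let $\hat\beta(\lambda)=\hat\beta_n(\lambda)$, $\lambda\in[\varepsilon,1]$, be estimators of $\beta$ ($\hat\beta(\lambda)$ being computed from $\lfloor n\lambda\rfloor$ individuals) which form a jointly measurable process with bounded paths. Assume that, as $n\to\infty$, $$\big\{\sqrt n\,(\hat\beta(\lambda)-\beta)\big\}_{\lambda\in[\varepsilon,1]}\ \rightsquigarrow\ \big\{\tfrac1\lambda D\,\vec{\mathbb B}(\lambda)\big\}_{\lambda\in[\varepsilon,1]}$$ weakly (in the sense of Hoffmann-Jørgensen) in the space $(\ell^\infty[\varepsilon,1])^T$ of bounded $\mathbb{R}^T$-valued functions with the supremum norm, where $\vec{\mathbb B}$ is a vector of $T$ independent standard Brownian motions and $D$ is a $T\times T$ real matrix of full rank. For $b\in\mathbb{R}^T$ put $b_{RMS}=\|b\|/\sqrt T$, where $\|\cdot\|$ is the Euclidean norm, write $\hat\beta_{RMS}(\lambda)=(\hat\beta(\lambda))_{RMS}$,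 and let $$\hat M_n=\frac{\hat\beta_{RMS}^2(1)-\beta_{RMS}^2}{\hat V_n},\qquad \hat V_n=\Big(\int_\varepsilon^1\big(\hat\beta_{RMS}^2(\lambda)-\hat\beta_{RMS}^2(1)\big)^2\,\nu(d\lambda)\Big)^{1/2}.$$ (1) If $\beta\neq 0$, then $\hat M_n$ converges in distribution to $$\mathbb W=\frac{\mathbb B(1)}{\big(\int_\varepsilon^1(\mathbb B(\lambda)/\lambda-\mathbb B(1))^2\,\nu(d\lambda)\big)^{1/2}},$$ where $\mathbb B$ is a one-dimensional standard Brownian motion. The denominator of $\mathbb W$ is almost surely positive, and the law of $\mathbb W$ is non-degenerate (not concentrated at one point). (2) If $\beta=0$, then $\hat M_n$ converges in distribution to $$\frac{\mathbb Z^2(1)}{\big(\int_\varepsilon^1(\mathbb Z^2(\lambda)-\mathbb Z^2(1))^2\,\nu(d\lambda)\big)^{1/2}},\qquad \mathbb Z^2(\lambda)=\frac1{\lambda^2}\,\vec{\mathbb B}(\lambda)'D'D\,\vec{\mathbb B}(\lambda),$$ where $\vec{\mathbb B}$ is a vector of $T$ independent standard Brownian motions and $D$ is the matrix above; the denominator is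 almost surely positive. -/

import Mathlib

open MeasureTheory ProbabilityTheory Filter Topology
open scoped NNReal ENNReal Matrix BoundedContinuousFunction

noncomputable section

/-- Outer expectation of a (bounded, not necessarily measurable) real function `g`: the infimum of
the expectations of the integrable measurable functions that dominate `g`. -/
def outerExpectation {Ω : Type*} [MeasurableSpace Ω] (P : Measure Ω) (g : Ω → ℝ) : ℝ :=
  sInf {a : ℝ | ∃ U : Ω → ℝ, Measurable U ∧ Integrable U P ∧ (∀ ω, g ω ≤ U ω) ∧ a = ∫ ω, U ω ∂P}

/-- Weak convergence in the sense of Hoffmann-Jørgensen: the maps `X n` are arbitrary, the limit `Z`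
is a Borel random element, and the outer expectations of `f (X n)` converge to the expectation of
`f Z` for each bounded continuous real function `f`. -/
structure ConvergesWeakly {E : Type*} [TopologicalSpace E] {Ω : ℕ → Type*}
    [∀ n, MeasurableSpace (Ω n)] (P : ∀ n, Measure (Ω n)) (X : ∀ n, Ω n → E)
    {Ω' : Type*} [MeasurableSpace Ω'] (P' : Measure Ω') (Z : Ω' → E) : Prop where
  aemeasurable : @AEMeasurable Ω' E (borel E) _ Z P'
  tendsto : ∀ f : E →ᵇ ℝ,
    Tendsto (fun n => outerExpectation (P n) (fun ω => f (X n ω))) atTop (𝓝 (∫ ω, f (Z ω) ∂P'))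

/-- A `T`-dimensional vector of independent standard Brownian motions. -/
structure IsBrownianVector {T : ℕ} {Ω : Type*} [MeasurableSpace Ω]
    (B : Fin T → ℝ≥0 → Ω → ℝ) (P : Measure Ω) : Prop where
  isBrownian : ∀ i, IsBrownianReal (B i) P
  indep : iIndepFun (fun i ω (t : ℝ≥0) => B i t ω) P

/-- The space of all bounded functions from `[ε, 1]` to `ℝ^T`, with the supremum norm. -/
abbrev BoundedPaths (T : ℕ) (ε : ℝ) : Type :=
  lp (fun _ : Set.Icc ε 1 => EuclideanSpace ℝ (Fin T)) ∞

/-- Sequential asymptotic normality: the processes `√n (β̂ₙ(l) - β)`, `l ∈ [ε, 1]`, have bounded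
paths and converge weakly, as random functions in the space of bounded functions on `[ε, 1]`, to
the process `l⁻¹ D B(l)`. -/
def SequentialAsymptoticNormality {T : ℕ} {ε : ℝ} {Ω : ℕ → Type*} [∀ n, MeasurableSpace (Ω n)]
    (P : ∀ n, Measure (Ω n)) (βhat : ∀ n, Ω n → Set.Icc ε 1 → EuclideanSpace ℝ (Fin T))
    (β : EuclideanSpace ℝ (Fin T)) (D : Matrix (Fin T) (Fin T) ℝ)
    {Ω' : Type*} [MeasurableSpace Ω'] (P' : Measure Ω') (B : Fin T → ℝ≥0 → Ω' → ℝ) : Prop :=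
  ∃ (X : ∀ n, Ω n → BoundedPaths T ε) (Z : Ω' → BoundedPaths T ε),
    (∀ n ω (l : Set.Icc ε 1), X n ω l = √(n : ℝ) • (βhat n ω l - β)) ∧
    (∀ᵐ ω ∂P', ∀ l : Set.Icc ε 1,
      Z ω l = (l : ℝ)⁻¹ • WithLp.toLp 2 (D *ᵥ fun i => B i (l : ℝ).toNNReal ω)) ∧
    ConvergesWeakly P X P' Z

/-- The root mean square `‖b‖ / √T` of a vector `b` in `ℝ^T`. -/
def rms {T : ℕ} (b : EuclideanSpace ℝ (Fin T)) : ℝ := ‖b‖ / √(T : ℝ)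

/-- The right end point `1` of the interval `[ε, 1]`. -/
def rightEnd {ε : ℝ} (hε1 : ε ≤ 1) : Set.Icc ε 1 := ⟨1, hε1, le_rfl⟩

/-- The normalizer `(∫ (rms² (b l) - rms² (b 1))² ν(dl))^{1/2}` of a path `b` of estimates. -/
def selfNormalizer {T : ℕ} {ε : ℝ} (hε1 : ε ≤ 1) (ν : Measure (Set.Icc ε 1))
    (b : Set.Icc ε 1 → EuclideanSpace ℝ (Fin T)) : ℝ :=
  √(∫ l, (rms (b l) ^ 2 - rms (b (rightEnd hε1)) ^ 2) ^ 2 ∂ν)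

/-- The self-normalized statistic of a path `b` of estimates of `β`. -/
def selfNormalizedStat {T : ℕ} {ε : ℝ} (hε1 : ε ≤ 1) (ν : Measure (Set.Icc ε 1))
    (β : EuclideanSpace ℝ (Fin T)) (b : Set.Icc ε 1 → EuclideanSpace ℝ (Fin T)) : ℝ :=
  (rms (b (rightEnd hε1)) ^ 2 - rms β ^ 2) / selfNormalizer hε1 ν b

/-- The denominator of the pivotal limit, for a real path `b`. -/
def pivotalDenominator {ε : ℝ} (ν : Measure (Set.Icc ε 1)) (b : ℝ≥0 → ℝ) : ℝ :=
  √(∫ l : Set.Icc ε 1, (b (l : ℝ).toNNReal / (l : ℝ) - b 1) ^ 2 ∂ν)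

/-- The quadratic form `l⁻² b(l)' D' D b(l)`, for a path `b` in `ℝ^T`. -/
def quadraticPath {T : ℕ} (D : Matrix (Fin T) (Fin T) ℝ) (b : Fin T → ℝ≥0 → ℝ) (l : ℝ) : ℝ :=
  1 / l ^ 2 * ((fun i => b i l.toNNReal) ⬝ᵥ ((Dᵀ * D) *ᵥ fun i => b i l.toNNReal))

/-- The denominator of the limit for `β = 0`, for a path `b` in `ℝ^T`. -/
def quadraticDenominator {T : ℕ} {ε : ℝ} (ν : Measure (Set.Icc ε 1))
    (D : Matrix (Fin T) (Fin T) ℝ) (b : Fin T → ℝ≥0 → ℝ) : ℝ :=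
  √(∫ l : Set.Icc ε 1, (quadraticPath D b l - quadraticPath D b 1) ^ 2 ∂ν)

end

/-! ### Continuous mapping for Hoffmann-Jørgensen convergence, and Slutsky with a deterministic
sequence. -/

section ContinuousMapping

variable {Ω' : Type*} {Ω : ℕ → Type*} [∀ n, MeasurableSpace (Ω n)] [MeasurableSpace Ω']
  {P : ∀ n, Measure (Ω n)} [∀ n, IsProbabilityMeasure (P n)]
  {P' : Measure Ω'} [IsProbabilityMeasure P']
  {S : Type*} [MeasurableSpace S] [TopologicalSpace S]

/-! Put `x = √n (β̂ - β)`. Expanding the squared norm at `β` gives `rms² (β̂ l) - rms² β = 2/(√n T)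
(⟨β, x l⟩ + ‖x l‖²/(2√n))`. The factor `2/(√n T)` occurs in numerator and normalizer and cancels, so
for `n > 0` the statistic is exactly a function of `1/√n` and of five functionals of `x`, each
continuous for the supremum norm (`selfNormalizedStat_eq_expandedStat`). No remainder has to be
estimated: continuous mapping into `ℝ⁵`, joint convergence with `1/√n → 0`, and the mapping theorem
for an almost surely continuous function give the limit. For `β = 0` only the quadratic term is
present, and two functionals suffice.

If `β ≠ 0`, the limit of `⟨β, x l⟩` is `⟨D'β, B(l)⟩ / l = σ W(l) / l`, where `σ = ‖D'β‖ > 0` by full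
rank and `W` is a standard Brownian motion; `σ` cancels in the ratio, which makes the limit pivotal.

Continuity of the final ratio requires an almost surely positive denominator. As `ν` charges `[ε,
1)`, its support contains some `l < 1`; paths are continuous, so a vanishing integral forces the
integrand to vanish at `l`. Given all other values, this confines the Gaussian increment of one
coordinate over `[l, 1]` to a countable set, an event of probability zero
(`IsBrownianVector.ae_notMem_of_countable_sections`). Finally, the limit law does not depend on the
Brownian motion chosen, since the integrals are limits of functions of finitely many marginals
(`IsBrownianVector.identDistrib_integral`). -/

lemma outerExpectation_eq_integral {Ω : Type*} [MeasurableSpace Ω] {P : Measure Ω} {g : Ω → ℝ}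
    (hg : Measurable g) (hi : Integrable g P) : outerExpectation P g = ∫ ω, g ω ∂P := by
  refine IsLeast.csInf_eq ⟨⟨g, hg, hi, fun _ => le_rfl, rfl⟩, ?_⟩
  rintro a ⟨U, -, hU, hgU, rfl⟩
  exact integral_mono hi hU hgU

lemma tendstoInDistribution_of_map_eq [OpensMeasurableSpace S] {Y : ∀ n, Ω n → S} {Z : Ω' → S}
    {μs : ℕ → ProbabilityMeasure S} {μ : ProbabilityMeasure S} (h : Tendsto μs atTop (𝓝 μ))
    (hY : ∀ n, AEMeasurable (Y n) (P n)) (hZ : AEMeasurable Z P')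
    (hYμ : ∀ n, (P n).map (Y n) = μs n) (hZμ : P'.map Z = μ) :
    TendstoInDistribution Y atTop Z P P' := by
  refine ⟨hY, hZ, ?_⟩
  obtain rfl : μs = fun n => ⟨_, Measure.isProbabilityMeasure_map (hY n)⟩ :=
    funext fun n => Subtype.ext (hYμ n).symm
  obtain rfl : μ = ⟨_, Measure.isProbabilityMeasure_map hZ⟩ := Subtype.ext hZμ.symm
  exact h

/-- The maps `X n` need not be measurable, but `Φ (X n)` is; for the test functions `f ∘ Φ` the
outer expectations are therefore ordinary integrals. -/
lemma ConvergesWeakly.tendstoInDistribution_comp [BorelSpace S] {E : Type*} [TopologicalSpace E]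
    {X : ∀ n, Ω n → E} {Z : Ω' → E} (h : ConvergesWeakly P X P' Z) {Φ : E → S}
    (hΦ : Continuous Φ) (hm : ∀ n, Measurable fun ω => Φ (X n ω)) :
    TendstoInDistribution (fun n ω => Φ (X n ω)) atTop (fun ω => Φ (Z ω)) P P' := by
  have hZ : AEMeasurable (fun ω => Φ (Z ω)) P' := by
    borelize E
    exact hΦ.measurable.comp_aemeasurable h.aemeasurable
  refine ⟨fun n => (hm n).aemeasurable, hZ, ?_⟩
  refine ProbabilityMeasure.tendsto_iff_forall_integral_tendsto.2 fun f => ?_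
  have := h.tendsto (f.compContinuous ⟨Φ, hΦ⟩)
  simp only [BoundedContinuousFunction.compContinuous_apply, ContinuousMap.coe_mk] at this
  simp only [ProbabilityMeasure.coe_mk]
  rw [integral_map hZ f.continuous.measurable.aestronglyMeasurable]
  refine this.congr fun n => ?_
  have hfm : Measurable fun ω => f (Φ (X n ω)) := f.continuous.measurable.comp (hm n)
  rw [outerExpectation_eq_integral hfm
      (.of_bound hfm.aestronglyMeasurable ‖f‖ (ae_of_all _ fun ω => f.norm_coe_le_norm _)),
    integral_map (hm n).aemeasurable f.continuous.measurable.aestronglyMeasurable]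

/-- Portmanteau with closed sets: a point of `closure (G ⁻¹' F)` at which `G` is continuous already
lies in `G ⁻¹' F`, so for the limit law the closure adds only a null set. -/
lemma ProbabilityMeasure.tendsto_map_of_ae_continuousAt [HasOuterApproxClosed S] [BorelSpace S]
    {S' : Type*} [MeasurableSpace S'] [TopologicalSpace S'] [HasOuterApproxClosed S']
    [BorelSpace S'] {μs : ℕ → ProbabilityMeasure S} {μ : ProbabilityMeasure S}
    (h : Tendsto μs atTop (𝓝 μ)) {G : S → S'} (hG : Measurable G)
    (hc : ∀ᵐ y ∂(μ : Measure S), ContinuousAt G y) :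
    Tendsto (fun n => (μs n).map hG.aemeasurable) atTop (𝓝 (μ.map hG.aemeasurable)) := by
  refine tendsto_of_forall_isClosed_limsup_le' fun F hF => ?_
  simp only [ProbabilityMeasure.toMeasure_map]
  rw [Measure.map_apply hG hF.measurableSet]
  simp_rw [Measure.map_apply hG hF.measurableSet]
  calc limsup (fun n => (μs n : Measure S) (G ⁻¹' F)) atTop
      ≤ limsup (fun n => (μs n : Measure S) (closure (G ⁻¹' F))) atTop :=
        limsup_le_limsup (Eventually.of_forall fun n => measure_mono subset_closure)
    _ ≤ (μ : Measure S) (closure (G ⁻¹' F)) :=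
        ProbabilityMeasure.limsup_measure_closed_le_of_tendsto h isClosed_closure
    _ ≤ (μ : Measure S) (G ⁻¹' F) := by
        refine measure_mono_ae ?_
        filter_upwards [hc] with y hy hyF
        exact hF.closure_subset_iff.2 (Set.image_preimage_subset G F)
          (mem_closure_image hy hyF)

lemma MeasureTheory.TendstoInDistribution.comp_of_ae_continuousAt [HasOuterApproxClosed S]
    [BorelSpace S] {Y : ∀ n, Ω n → S} {Z : Ω' → S} (h : TendstoInDistribution Y atTop Z P P')
    {G : S → ℝ} (hG : Measurable G) (hc : ∀ᵐ ω ∂P', ContinuousAt G (Z ω)) :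
    TendstoInDistribution (fun n ω => G (Y n ω)) atTop (fun ω => G (Z ω)) P P' := by
  exact tendstoInDistribution_of_map_eq
    (ProbabilityMeasure.tendsto_map_of_ae_continuousAt h.tendsto hG
      ((ae_map_iff h.aemeasurable_limit (measurableSet_of_continuousAt G)).2 hc))
    (fun n => hG.comp_aemeasurable (h.forall_aemeasurable n))
    (hG.comp_aemeasurable h.aemeasurable_limit)
    (fun n => (AEMeasurable.map_map_of_aemeasurable hG.aemeasurable
      (h.forall_aemeasurable n)).symm)
    (AEMeasurable.map_map_of_aemeasurable hG.aemeasurable h.aemeasurable_limit).symm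

lemma map_prodMk_const {Ω S R : Type*} [MeasurableSpace Ω] [MeasurableSpace S] [MeasurableSpace R]
    {Q : Measure Ω} [SFinite Q] {Y : Ω → S} (hY : AEMeasurable Y Q) (a : R) :
    Q.map (fun ω => (Y ω, a)) = (Q.map Y).prod (Measure.dirac a) := by
  rw [Measure.prod_dirac, AEMeasurable.map_map_of_aemeasurable (by fun_prop) hY]
  rfl

/-- The second component is deterministic, so the joint law is a product with a Dirac mass, and
forming products of probability measures is weakly continuous. -/
lemma MeasureTheory.TendstoInDistribution.prodMk_const_of_tendsto {S : Type*} [MeasurableSpace S]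
    [PseudoEMetricSpace S] [SecondCountableTopology S] [BorelSpace S]
    {Y : ∀ n, Ω n → S} {Z : Ω' → S} (h : TendstoInDistribution Y atTop Z P P') {r : ℕ → ℝ} {c : ℝ}
    (hr : Tendsto r atTop (𝓝 c)) :
    TendstoInDistribution (fun n ω => (Y n ω, r n)) atTop (fun ω => (Z ω, c)) P P' := by
  have hd : Tendsto (fun n => diracProba (r n)) atTop (𝓝 (diracProba c)) :=
    (continuous_diracProba.tendsto c).comp hr
  have := (ProbabilityMeasure.continuous_prod.tendsto (_, diracProba c)).comp
    (h.tendsto.prodMk_nhds hd)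
  exact tendstoInDistribution_of_map_eq this
    (fun n => (h.forall_aemeasurable n).prodMk aemeasurable_const)
    (h.aemeasurable_limit.prodMk aemeasurable_const)
    (fun n => map_prodMk_const (h.forall_aemeasurable n) _)
    (map_prodMk_const h.aemeasurable_limit _)

lemma MeasureTheory.TendstoInDistribution.congr_map {Ω'' : Type*} [MeasurableSpace Ω'']
    {P'' : Measure Ω''} [IsProbabilityMeasure P''] [OpensMeasurableSpace S]
    {Y : ∀ n, Ω n → S} {Z : Ω' → S} {W : Ω'' → S} (h : TendstoInDistribution Y atTop Z P P')
    (hW : IdentDistrib Z W P' P'') :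
    TendstoInDistribution Y atTop W P P'' := by
  exact tendstoInDistribution_of_map_eq h.tendsto h.forall_aemeasurable hW.aemeasurable_snd
    (fun n => rfl) hW.map_eq.symm

lemma MeasureTheory.TendstoInDistribution.congr_eventually [OpensMeasurableSpace S]
    {Y Y' : ∀ n, Ω n → S} {Z : Ω' → S} (h : TendstoInDistribution Y atTop Z P P')
    (hm : ∀ n, AEMeasurable (Y' n) (P n)) (he : ∀ᶠ n in atTop, Y n = Y' n) :
    TendstoInDistribution Y' atTop Z P P' := by
  refine ⟨hm, h.aemeasurable_limit, ?_⟩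
  refine h.tendsto.congr' ?_
  filter_upwards [he] with n hn
  exact Subtype.ext (congrArg (Measure.map · (P n)) hn)

end ContinuousMapping

/-! ### Integral functionals of bounded paths. -/

section PathFunctional

variable {I : Type*} [MeasurableSpace I] {V : Type*}

/-- The functional `x ↦ ∫ F (x l) (x a) ν(dl)` of a path `x`, as a lower integral, which makes it
continuous also at paths that are not measurable. -/
noncomputable def pathFunctional (ν : Measure I) (a : I) (F : V × V → ℝ) (x : I → V) : ℝ :=
  (∫⁻ l, ENNReal.ofReal (F (x l, x a)) ∂ν).toReal

lemma pathFunctional_eq_integral {ν : Measure I} {a : I} {F : V × V → ℝ} {x : I → V}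
    (h0 : ∀ p, 0 ≤ F p) (hm : AEStronglyMeasurable (fun l => F (x l, x a)) ν) :
    pathFunctional ν a F x = ∫ l, F (x l, x a) ∂ν :=
  (integral_eq_lintegral_of_nonneg_ae (ae_of_all _ fun _ => h0 _) hm).symm

lemma measurable_pathFunctional [MeasurableSpace V] {Ω : Type*} [MeasurableSpace Ω]
    {ν : Measure I} [SFinite ν] {a : I}
    {F : V × V → ℝ} (hF : Measurable F) {X : Ω → I → V}
    (hX : Measurable fun p : Ω × I => X p.1 p.2) :
    Measurable fun ω => pathFunctional ν a F (X ω) := by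
  refine (Measurable.lintegral_prod_right' (f := fun p : Ω × I =>
    ENNReal.ofReal (F (X p.1 p.2, X p.1 a))) ?_).ennreal_toReal
  have : Measurable fun p : Ω × I => X p.1 a :=
    hX.comp (measurable_fst.prodMk measurable_const)
  exact (hF.comp (hX.prodMk this)).ennreal_ofReal

/-- Paths near `x` take values in one compact ball, where `F` is uniformly continuous; uniform
closeness of the integrands suffices because `ν` is finite. -/
lemma continuous_pathFunctional [NormedAddCommGroup V] [ProperSpace V] (ν : Measure I)
    [IsFiniteMeasure ν] (a : I)
    {F : V × V → ℝ} (hF : Continuous F) :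
    Continuous fun x : lp (fun _ : I => V) ∞ => pathFunctional ν a F x := by
  have hb (y : lp (fun _ : I => V) ∞) (l : I) : ‖y l‖ ≤ ‖y‖ :=
    lp.norm_apply_le_norm ENNReal.top_ne_zero y l
  have hfin (x : lp (fun _ : I => V) ∞) :
      ∫⁻ l, ENNReal.ofReal (F (x l, x a)) ∂ν ≠ ∞ := by
    have hK : IsCompact (Metric.closedBall (0 : V × V) ‖x‖) := isCompact_closedBall _ _
    obtain ⟨C, hC⟩ := hK.exists_bound_of_continuousOn hF.continuousOn
    refine ne_top_of_le_ne_top (b := ∫⁻ _, ENNReal.ofReal C ∂ν) ?_ (lintegral_mono fun l => ?_)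
    · rw [lintegral_const]
      exact ENNReal.mul_ne_top ENNReal.ofReal_ne_top (measure_ne_top _ _)
    · refine ENNReal.ofReal_le_ofReal ((le_abs_self _).trans (hC _ ?_))
      simp [Prod.norm_def, hb]
  rw [continuous_iff_continuousAt]
  intro x
  rw [Metric.continuousAt_iff]
  intro e he
  have hK : IsCompact (Metric.closedBall (0 : V × V) (‖x‖ + 1)) := isCompact_closedBall _ _
  have huc := hK.uniformContinuousOn_of_continuous hF.continuousOn
  -- The summand `1` covers `ν = 0` and makes `η * ν.real Set.univ < e` strict.
  set η : ℝ := e / (ν.real Set.univ + 1) with hη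
  have hνpos : 0 < ν.real Set.univ + 1 := by positivity
  have hη0 : 0 < η := by positivity
  obtain ⟨δ, hδ, H⟩ := Metric.uniformContinuousOn_iff.1 huc η hη0
  refine ⟨min δ 1, by positivity, fun y hy => ?_⟩
  have hxy : ∀ l, dist (y l) (x l) < min δ 1 := fun l => by
    refine lt_of_le_of_lt ?_ hy
    rw [dist_eq_norm, dist_eq_norm]
    exact hb (y - x) l
  have hyn : ‖y‖ ≤ ‖x‖ + 1 := by
    have := norm_le_norm_add_norm_sub' y x
    rw [← dist_eq_norm] at this
    have := hy.trans_le (min_le_right _ _)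
    linarith
  have hclose : ∀ l, |F (y l, y a) - F (x l, x a)| < η := fun l => by
    rw [← Real.dist_eq]
    refine H _ ?_ _ ?_ ?_
    · simp only [mem_closedBall_zero_iff, Prod.norm_def, sup_le_iff]
      exact ⟨(hb y l).trans hyn, (hb y a).trans hyn⟩
    · simp only [mem_closedBall_zero_iff, Prod.norm_def, sup_le_iff]
      exact ⟨(hb x l).trans (by linarith), (hb x a).trans (by linarith)⟩
    · rw [Prod.dist_eq]
      exact max_lt ((hxy l).trans_le (min_le_left _ _)) ((hxy a).trans_le (min_le_left _ _))
  have hle (u v : lp (fun _ : I => V) ∞) (huv : ∀ l, F (u l, u a) - F (v l, v a) ≤ η) :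
      pathFunctional ν a F u ≤ pathFunctional ν a F v + η * ν.real Set.univ := by
    unfold pathFunctional
    have h1 : ∫⁻ l, ENNReal.ofReal (F (u l, u a)) ∂ν ≤
        ∫⁻ l, ENNReal.ofReal (F (v l, v a)) ∂ν + ENNReal.ofReal η * ν Set.univ := by
      -- Only the constant summand has to be measurable here, so arbitrary bounded paths are
      -- allowed.
      rw [← lintegral_const, ← lintegral_add_right _ measurable_const]
      refine lintegral_mono fun l => ?_
      refine (ENNReal.ofReal_le_ofReal (q := F (v l, v a) + η) ?_).trans ENNReal.ofReal_add_le
      linarith [huv l]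
    have htop : ENNReal.ofReal η * ν Set.univ ≠ ∞ :=
      ENNReal.mul_ne_top ENNReal.ofReal_ne_top (measure_ne_top _ _)
    have h2 := ENNReal.toReal_mono (ENNReal.add_ne_top.2 ⟨hfin v, htop⟩) h1
    rwa [ENNReal.toReal_add (hfin v) htop, ENNReal.toReal_mul, ENNReal.toReal_ofReal hη0.le] at h2
  have hlt : η * ν.real Set.univ < e := by
    rw [hη, div_mul_eq_mul_div, div_lt_iff₀ hνpos]
    nlinarith
  rw [Real.dist_eq, abs_lt]
  have h1 := hle y x fun l => (abs_lt.1 (hclose l)).2.le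
  have h2 := hle x y fun l => by have := (abs_lt.1 (hclose l)).1; linarith
  constructor <;> linarith

end PathFunctional

/-! ### Linear combinations and increments of a Brownian vector. -/

section BrownianVector

variable {T : ℕ} {Ω Ω' : Type*} [MeasurableSpace Ω] [MeasurableSpace Ω'] {P : Measure Ω}
  {P' : Measure Ω'}
  {B : Fin T → ℝ≥0 → Ω → ℝ} {B' : Fin T → ℝ≥0 → Ω' → ℝ}

lemma ProbabilityTheory.IsBrownianReal.isBrownianVector [IsProbabilityMeasure P]
    {B : ℝ≥0 → Ω → ℝ}
    (hB : IsBrownianReal B P) : IsBrownianVector (fun _ : Fin 1 => B) P :=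
  ⟨fun _ => hB, iIndepFun.of_subsingleton⟩

lemma IsBrownianVector.ae_continuous (hB : IsBrownianVector B P) :
    ∀ᵐ ω ∂P, ∀ i, Continuous fun t => B i t ω :=
  ae_all_iff.2 fun i => (hB.isBrownian i).cont

lemma IsBrownianVector.identDistrib_eval (hB : IsBrownianVector B P) (hB' : IsBrownianVector B' P')
    {K : Type*} [Finite K] (t : K → ℝ≥0) :
    IdentDistrib (fun ω i k => B i (t k) ω) (fun ω i k => B' i (t k) ω) P P' := by
  have hm : Measurable fun (x : ℝ≥0 → ℝ) (k : K) => x (t k) := by fun_prop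
  refine IdentDistrib.pi (X := fun i ω k => B i (t k) ω) (Y := fun i ω k => B' i (t k) ω)
    (fun i => ?_) (hB.indep.comp _ fun _ => hm) (hB'.indep.comp _ fun _ => hm)
  have hI : ∀ k, t k ∈ (Set.finite_range t).toFinset := by simp
  have h := (hB.isBrownian i).hasLaw (Set.finite_range t).toFinset
  have h' := (hB'.isBrownian i).hasLaw (Set.finite_range t).toFinset
  exact (h.identDistrib h').comp (u := fun x k => x ⟨t k, hI k⟩) (by fun_prop)

variable [IsProbabilityMeasure P]

/-- The sum is a centred Gaussian process; by independence the cross terms vanish and its covariance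
is `(∑ i, c i ^ 2) * min s t`. -/
lemma IsBrownianVector.isBrownianReal_sum (hB : IsBrownianVector B P) {c : Fin T → ℝ}
    (hc : ∑ i, c i ^ 2 = 1) : IsBrownianReal (fun t ω => ∑ i, c i * B i t ω) P where
  toIsPreBrownianReal := by
    have hL (i t) : MemLp (fun ω => c i * B i t ω) 2 P :=
      ((hB.isBrownian i).hasLaw_eval t).hasGaussianLaw.memLp_two.const_mul _
    refine IsGaussianProcess.isPreBrownianReal_of_covariance ⟨fun I => ?_⟩ (fun t => ?_)
      fun s t hst => ?_
    · have h1 : HasGaussianLaw (fun ω => ∑ i, fun t : I => c i * B i t ω) P := by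
        refine iIndepFun.hasGaussianLaw_fun_sum (X := fun i ω (t : I) => c i * B i t ω)
          (fun i => ?_) (hB.indep.comp (fun i x (t : I) => c i * x t) fun i => by fun_prop)
        exact ((hB.isBrownian i).hasLaw I).hasGaussianLaw.smul (c i)
      convert h1 using 1
      ext ω t
      simp
    · rw [integral_finsetSum _ fun i _ => (hL i t).integrable one_le_two]
      simp [integral_const_mul, (hB.isBrownian _).integral_eval]
    · rw [covariance_fun_sum_fun_sum (hL · s) (hL · t)]
      rw [Finset.sum_congr rfl fun i _ => Finset.sum_eq_single i (fun j _ hj => ?_) (by simp)]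
      · simp_rw [covariance_const_mul_left, covariance_const_mul_right,
          (hB.isBrownian _).covariance_fun_eval, min_eq_left hst, ← mul_assoc, ← Finset.sum_mul,
          ← sq, hc, one_mul]
      · refine IndepFun.covariance_eq_zero ?_ (hL i s) (hL j t)
        exact (hB.indep.indepFun hj.symm).comp (φ := fun x => c i * x s) (ψ := fun x => c j * x t)
          (by fun_prop) (by fun_prop)
  cont := by
    filter_upwards [hB.ae_continuous] with ω hω
    fun_prop

lemma measure_prodMk_mem_eq_zero {M : Type*} [MeasurableSpace M] {R : Ω → M} {V : Ω → ℝ}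
    (hR : AEMeasurable R P) (hV : AEMeasurable V P) (hRV : IndepFun R V P)
    {S : Set (M × ℝ)} (hS : MeasurableSet S) (h0 : ∀ m, P.map V {v | (m, v) ∈ S} = 0) :
    P {ω | (R ω, V ω) ∈ S} = 0 := by
  have h : P {ω | (R ω, V ω) ∈ S} = P.map (fun ω => (R ω, V ω)) S :=
    (Measure.map_apply_of_aemeasurable (hR.prodMk hV) hS).symm
  have : IsProbabilityMeasure (P.map V) := Measure.isProbabilityMeasure_map hV
  rw [h, (indepFun_iff_map_prod_eq_prod_map_map hR hV).1 hRV, Measure.measure_prod_null hS]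
  exact ae_of_all _ h0

/-- Given everything else, the increment of one coordinate over `[s, 1]` has no atoms, so that
`(B s, B 1)` avoids every set with countable sections in the direction of that coordinate of
`B 1`. -/
lemma IsBrownianVector.ae_notMem_of_countable_sections (hB : IsBrownianVector B P) {s : ℝ≥0}
    (hs : s < 1) (i₀ : Fin T) {S : Set ((Fin T → ℝ) × (Fin T → ℝ))} (hS : MeasurableSet S)
    (hc : ∀ a w, {v | (a, Function.update w i₀ v) ∈ S}.Countable) :
    ∀ᵐ ω ∂P, ((fun i => B i s ω), (fun i => B i 1 ω)) ∉ S := by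
  classical
  set U : Ω → ℝ := B i₀ s
  set V : Ω → ℝ := fun ω => B i₀ 1 ω - B i₀ s ω
  set J : Finset (Fin T) := Finset.univ.erase i₀
  set R : Ω → (J → ℝ × ℝ) := fun ω j => (B j s ω, B j 1 ω)
  have hm (i t) : AEMeasurable (B i t) P := (hB.isBrownian i).aemeasurable t
  have hU : AEMeasurable U P := hm _ _
  have hV : AEMeasurable V P := (hm _ _).sub (hm _ _)
  have hR : AEMeasurable R P := aemeasurable_pi_lambda _ fun j => (hm _ _).prodMk (hm _ _)
  have hUV : IndepFun U V P := by
    have h : IndepFun (fun ω => B i₀ (s + (1 - s)) ω - B i₀ s ω) U P :=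
      ((hB.isBrownian i₀).indepFun_shift s).comp
      (φ := fun x : ℝ≥0 → ℝ => x (1 - s))
      (ψ := fun x : Set.Iic s → ℝ => x ⟨s, Set.self_mem_Iic⟩)
      (measurable_pi_apply _) (measurable_pi_apply _)
    convert h.symm using 1
    ext ω
    simp [V, add_tsub_cancel_of_le hs.le]
  have hRUV : IndepFun R (fun ω => (U ω, V ω)) P := by
    have h1 : iIndepFun (fun i ω => (B i s ω, B i 1 ω)) P :=
      hB.indep.comp (fun _ x => (x s, x 1)) fun _ => by fun_prop
    have h2 := h1.indepFun_finset₀ J {i₀} (by simp [J]) fun i => (hm _ _).prodMk (hm _ _)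
    exact h2.comp (φ := id) (ψ := fun x : ({i₀} : Finset (Fin T)) → ℝ × ℝ =>
      ((x ⟨i₀, by simp⟩).1, (x ⟨i₀, by simp⟩).2 - (x ⟨i₀, by simp⟩).1)) measurable_id (by fun_prop)
  -- From `R` independent of `(U, V)` and `U` independent of `V`, the joint law is a triple product,
  -- which is then reassociated.
  have hRU_V : IndepFun (fun ω => (R ω, U ω)) V P := by
    rw [indepFun_iff_map_prod_eq_prod_map_map (hR.prodMk hU) hV]
    have h1 := (indepFun_iff_map_prod_eq_prod_map_map hR (hU.prodMk hV)).1 hRUV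
    have h2 := (indepFun_iff_map_prod_eq_prod_map_map hU hV).1 hUV
    have h3 := (indepFun_iff_map_prod_eq_prod_map_map hR hU).1
      (hRUV.comp (φ := id) (ψ := Prod.fst) measurable_id measurable_fst)
    have : IsProbabilityMeasure (P.map U) := Measure.isProbabilityMeasure_map hU
    have : IsProbabilityMeasure (P.map V) := Measure.isProbabilityMeasure_map hV
    have : IsProbabilityMeasure (P.map R) := Measure.isProbabilityMeasure_map hR
    rw [h3, ← (measurePreserving_prodAssoc (P.map R) (P.map U) (P.map V)).symm.map_eq, ← h2, ← h1,
      AEMeasurable.map_map_of_aemeasurable (by fun_prop) (hR.prodMk (hU.prodMk hV))]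
    rfl
  have hgauss : HasLaw V (gaussianReal 0 (nndist (1 : ℝ) (s : ℝ))) P :=
    (hB.isBrownian i₀).hasLaw_sub 1 s
  have : NullSingletonClass (P.map V) := by
    rw [hgauss.map_eq]
    refine nullSingletonClass_gaussianReal ?_
    simpa [nndist_eq_zero] using fun h : (1 : ℝ) = s => hs.ne' (by exact_mod_cast h)
  -- `Ψ` rebuilds `(B s, B 1)` from the other coordinates `R`, the value `U` and the increment `V`.
  -- The default `0` in `w` at `i₀` is overwritten by `Function.update`.
  let w (r : J → ℝ × ℝ) (i : Fin T) : ℝ := if h : i ∈ J then (r ⟨i, h⟩).2 else 0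
  let a (m : (J → ℝ × ℝ) × ℝ) (i : Fin T) : ℝ := if h : i ∈ J then (m.1 ⟨i, h⟩).1 else m.2
  have hw : Measurable w := measurable_pi_lambda _ fun i => by
    by_cases h : i ∈ J <;> simp only [w, h, dite_true, dite_false] <;> fun_prop
  have ha : Measurable a := measurable_pi_lambda _ fun i => by
    by_cases h : i ∈ J <;> simp only [a, h, dite_true, dite_false] <;> fun_prop
  let Ψ (p : ((J → ℝ × ℝ) × ℝ) × ℝ) : (Fin T → ℝ) × (Fin T → ℝ) :=
    (a p.1, Function.update (w p.1.1) i₀ (p.1.2 + p.2))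
  have hΨ : Measurable Ψ := by
    refine (ha.comp measurable_fst).prodMk (measurable_pi_lambda _ fun i => ?_)
    by_cases h : i = i₀
    · subst h
      simp only [Function.update_self]
      fun_prop
    · simp only [Function.update_of_ne h]
      exact (measurable_pi_apply i).comp (hw.comp (measurable_fst.comp measurable_fst))
  have h0 := measure_prodMk_mem_eq_zero (hR.prodMk hU) hV hRU_V (hΨ hS) fun m => by
    refine Set.Countable.measure_zero ?_ _
    exact (hc (a m) (w m.1)).preimage (f := fun v => m.2 + v) (add_right_injective m.2)
  have hsub : ∀ ω, Ψ ((R ω, U ω), V ω) = ((fun i => B i s ω), (fun i => B i 1 ω)) := fun ω => by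
    refine Prod.ext (funext fun i => ?_) (funext fun i => ?_)
    · by_cases h : i = i₀
      · subst h; simp [Ψ, a, J, U]
      · simp [Ψ, a, J, h, R]
    · by_cases h : i = i₀
      · subst h; simp [Ψ, U, V]
      · simp [Ψ, w, J, h, R]
  rw [ae_iff]
  simpa [Set.mem_preimage, hsub] using h0

end BrownianVector

/-! ### The law of integral functionals is the same for all Brownian vectors. -/

section PathLaw

lemma ProbabilityTheory.IdentDistrib.of_ae_tendsto {Ω Ω' S : Type*} [MeasurableSpace Ω]
    [MeasurableSpace Ω'] {P : Measure Ω} {P' : Measure Ω'} [IsProbabilityMeasure P]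
    [IsProbabilityMeasure P'] [MeasurableSpace S] [PseudoEMetricSpace S] [BorelSpace S]
    {Y : ℕ → Ω → S} {Y' : ℕ → Ω' → S} {Z : Ω → S} {Z' : Ω' → S}
    (h : ∀ n, IdentDistrib (Y n) (Y' n) P P')
    (hZ : ∀ᵐ ω ∂P, Tendsto (fun n => Y n ω) atTop (𝓝 (Z ω)))
    (hZ' : ∀ᵐ ω ∂P', Tendsto (fun n => Y' n ω) atTop (𝓝 (Z' ω))) :
    IdentDistrib Z Z' P P' := by
  have hY n := (h n).aemeasurable_fst
  have hY' n := (h n).aemeasurable_snd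
  have hm := aemeasurable_of_tendsto_metrizable_ae atTop hY hZ
  have hm' := aemeasurable_of_tendsto_metrizable_ae atTop hY' hZ'
  -- `Y' n` has the law of `Y n`, so it converges in distribution to `Z` as well as to `Z'`; limits
  -- in distribution are unique.
  have h1 : TendstoInDistribution Y' atTop Z (fun _ => P') P :=
    tendstoInDistribution_of_map_eq (tendstoInDistribution_of_ae_tendsto hY hm hZ).tendsto hY' hm
      (fun n => (h n).map_eq.symm) rfl
  exact ⟨hm, hm', tendstoInDistribution_unique Y' h1
    (tendstoInDistribution_of_ae_tendsto hY' hm' hZ')⟩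

variable {T : ℕ} {Ω Ω' : Type*} [MeasurableSpace Ω] [MeasurableSpace Ω'] {P : Measure Ω}
  {P' : Measure Ω'} [IsProbabilityMeasure P] [IsProbabilityMeasure P']
  {B : Fin T → ℝ≥0 → Ω → ℝ} {B' : Fin T → ℝ≥0 → Ω' → ℝ} {ε : ℝ}

lemma tendsto_integral_comp_approximation (ν : Measure (Set.Icc ε 1)) [IsFiniteMeasure ν]
    {V : Type*} [TopologicalSpace V] [MeasurableSpace V] [BorelSpace V]
    [SecondCountableTopology V]
    {g : Set.Icc ε 1 × V × V → ℝ} (hg : Continuous g)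
    {b : Set.Icc ε 1 → V} (hb : Continuous b) (v : V)
    {s : ℕ → Set.Icc ε 1 → Set.Icc ε 1} (hs : ∀ n, Measurable (s n))
    (hlim : ∀ l, Tendsto (fun n => s n l) atTop (𝓝 l)) :
    Tendsto (fun n => ∫ l, g (l, b (s n l), v) ∂ν) atTop (𝓝 (∫ l, g (l, b l, v) ∂ν)) := by
  have hc : Continuous fun p : Set.Icc ε 1 × Set.Icc ε 1 => g (p.1, b p.2, v) := by fun_prop
  obtain ⟨C, hC⟩ := (isCompact_univ (X := Set.Icc ε 1 × Set.Icc ε 1)).exists_bound_of_continuousOn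
    hc.continuousOn
  refine tendsto_integral_of_dominated_convergence (fun _ => C) (fun n => ?_)
    (integrable_const C) (fun n => ae_of_all _ fun l => hC (l, s n l) trivial)
    (ae_of_all _ fun l => ?_)
  · exact (hc.measurable.comp (measurable_id.prodMk (hs n))).aestronglyMeasurable
  · exact (hc.tendsto (l, l)).comp (tendsto_const_nhds.prodMk_nhds (hlim l))

/-- Rounding the time in the path to a simple function turns the integral into a measurable function
of finitely many marginals, whose joint law is determined. Continuity of the paths and dominated
convergence then remove the rounding. -/
lemma IsBrownianVector.identDistrib_integral (hB : IsBrownianVector B P)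
    (hB' : IsBrownianVector B' P') (hε1 : ε ≤ 1) (ν : Measure (Set.Icc ε 1)) [IsFiniteMeasure ν]
    {g : Set.Icc ε 1 × (Fin T → ℝ) × (Fin T → ℝ) → ℝ} (hg : Continuous g) :
    IdentDistrib
      (fun ω => ((fun i => B i 1 ω),
        ∫ l, g (l, (fun i => B i (l : ℝ).toNNReal ω), fun i => B i 1 ω) ∂ν))
      (fun ω => ((fun i => B' i 1 ω),
        ∫ l, g (l, (fun i => B' i (l : ℝ).toNNReal ω), fun i => B' i 1 ω) ∂ν)) P P' := by
  let s (n : ℕ) : SimpleFunc (Set.Icc ε 1) (Set.Icc ε 1) :=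
    SimpleFunc.approxOn id measurable_id Set.univ ⟨1, hε1, le_rfl⟩ (Set.mem_univ _) n
  have hs : ∀ l, Tendsto (fun n => s n l) atTop (𝓝 l) := fun l =>
    SimpleFunc.tendsto_approxOn measurable_id (Set.mem_univ _) (by simp)
  let π (n : ℕ) (l : Set.Icc ε 1) : (s n).range := ⟨s n l, SimpleFunc.mem_range_self _ _⟩
  have hπ n : Measurable (π n) := (s n).measurable.subtype_mk
  -- The index `none` stands for time `1`, which need not be a value of `s n`.
  let t (n : ℕ) (k : Option (s n).range) : ℝ≥0 :=
    k.elim 1 fun l => ((l : Set.Icc ε 1) : ℝ).toNNReal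
  let F (n : ℕ) (x : Fin T → Option (s n).range → ℝ) : (Fin T → ℝ) × ℝ :=
    ((fun i => x i none), ∫ l, g (l, (fun i => x i (some (π n l))), fun i => x i none) ∂ν)
  have hF n : Measurable (F n) := by
    refine Measurable.prodMk (by fun_prop) ?_
    have hev : Measurable fun p : (Fin T → Option (s n).range → ℝ) × (s n).range =>
        fun i => p.1 i (some p.2) := by
      refine measurable_from_prod_countable_left fun k => ?_
      exact measurable_pi_lambda _ fun i =>
        (measurable_pi_apply (some k)).comp (measurable_pi_apply i)
    have hm : Measurable fun p : (Fin T → Option (s n).range → ℝ) × Set.Icc ε 1 =>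
        g (p.2, (fun i => p.1 i (some (π n p.2))), fun i => p.1 i none) := by
      refine hg.measurable.comp (measurable_snd.prodMk (Measurable.prodMk ?_ (by fun_prop)))
      exact hev.comp (measurable_fst.prodMk ((hπ n).comp measurable_snd))
    exact hm.stronglyMeasurable.integral_prod_right'.measurable
  have key (b : Fin T → ℝ≥0 → ℝ) (hb : ∀ i, Continuous (b i)) :
      Tendsto (fun n => F n fun i k => b i (t n k)) atTop (𝓝 ((fun i => b i 1),
        ∫ l, g (l, (fun i => b i (l : ℝ).toNNReal), fun i => b i 1) ∂ν)) :=
    tendsto_const_nhds.prodMk_nhds <| tendsto_integral_comp_approximation ν hg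
      (b := fun l i => b i (l : ℝ).toNNReal) (by fun_prop) _ (fun n => (s n).measurable) hs
  exact .of_ae_tendsto (fun n => (hB.identDistrib_eval hB' (t n)).comp (hF n))
    (hB.ae_continuous.mono fun ω => key _) (hB'.ae_continuous.mono fun ω => key _)

lemma ProbabilityTheory.IsBrownianReal.identDistrib_div_pivotalDenominator {B : ℝ≥0 → Ω → ℝ}
    {B' : ℝ≥0 → Ω' → ℝ} (hB : IsBrownianReal B P) (hB' : IsBrownianReal B' P') (hε : 0 < ε)
    (hε1 : ε ≤ 1) (ν : Measure (Set.Icc ε 1)) [IsFiniteMeasure ν] :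
    IdentDistrib (fun ω => B 1 ω / pivotalDenominator ν fun t => B t ω)
      (fun ω => B' 1 ω / pivotalDenominator ν fun t => B' t ω) P P' := by
  have hg : Continuous fun p : Set.Icc ε 1 × (Fin 1 → ℝ) × (Fin 1 → ℝ) =>
      (p.2.1 0 / (p.1 : ℝ) - p.2.2 0) ^ 2 :=
    ((Continuous.div₀ (by fun_prop) (by fun_prop) fun p => (hε.trans_le p.1.2.1).ne').sub
      (by fun_prop)).pow 2
  exact (hB.isBrownianVector.identDistrib_integral hB'.isBrownianVector hε1 ν hg).comp
    (u := fun p => p.1 0 / √p.2) (by fun_prop)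

lemma IsBrownianVector.identDistrib_div_quadraticDenominator (hB : IsBrownianVector B P)
    (hB' : IsBrownianVector B' P') (hε : 0 < ε) (hε1 : ε ≤ 1) (ν : Measure (Set.Icc ε 1))
    [IsFiniteMeasure ν] (D : Matrix (Fin T) (Fin T) ℝ) :
    IdentDistrib (fun ω => quadraticPath D (fun i t => B i t ω) 1 /
        quadraticDenominator ν D fun i t => B i t ω)
      (fun ω => quadraticPath D (fun i t => B' i t ω) 1 /
        quadraticDenominator ν D fun i t => B' i t ω) P P' := by
  have hq : Continuous fun x : Fin T → ℝ => x ⬝ᵥ ((Dᵀ * D) *ᵥ x) :=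
    continuous_id.dotProduct (continuous_const.matrix_mulVec continuous_id)
  have hg : Continuous fun p : Set.Icc ε 1 × (Fin T → ℝ) × (Fin T → ℝ) =>
      (1 / (p.1 : ℝ) ^ 2 * (p.2.1 ⬝ᵥ ((Dᵀ * D) *ᵥ p.2.1)) - p.2.2 ⬝ᵥ ((Dᵀ * D) *ᵥ p.2.2)) ^ 2 :=
    (((Continuous.div₀ (by fun_prop) (by fun_prop) fun p =>
      (pow_pos (hε.trans_le p.1.2.1) 2).ne').mul (hq.comp (by fun_prop))).sub
      (hq.comp (by fun_prop))).pow 2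
  have h := (hB.identDistrib_integral hB' hε1 ν hg).comp
    (u := fun p => p.1 ⬝ᵥ ((Dᵀ * D) *ᵥ p.1) / √p.2)
    ((hq.measurable.comp measurable_fst).div (by fun_prop))
  simpa [quadraticDenominator, quadraticPath, Function.comp_def] using h

end PathLaw

/-! ### Positive denominators and non-degeneracy of the pivotal limit. -/

section Positivity

variable {ε : ℝ} {ν : Measure (Set.Icc ε 1)} [IsFiniteMeasure ν]

omit [IsFiniteMeasure ν] in
lemma exists_mem_support_lt_one (hν : ν {l | (l : ℝ) < 1} ≠ 0) : ∃ l ∈ ν.support, (l : ℝ) < 1 := by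
  obtain ⟨l, h1, h2⟩ := Measure.nonempty_inter_support_of_pos (pos_iff_ne_zero.2 hν)
  exact ⟨l, h2, h1⟩

/-- By continuity `h` is nonzero on a neighbourhood of `l`, and neighbourhoods of support points
have positive measure. -/
lemma integral_sq_pos_of_mem_support {h : Set.Icc ε 1 → ℝ} (hc : Continuous h) {l : Set.Icc ε 1}
    (hl : l ∈ ν.support) (hne : h l ≠ 0) : 0 < ∫ x, h x ^ 2 ∂ν := by
  obtain ⟨C, hC⟩ := (isCompact_univ (X := Set.Icc ε 1)).exists_bound_of_continuousOn
    (hc.pow 2).continuousOn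
  have hint : Integrable (fun x => h x ^ 2) ν :=
    .of_bound (hc.pow 2).measurable.aestronglyMeasurable C (ae_of_all _ fun x => hC x trivial)
  rw [integral_pos_iff_support_of_nonneg (fun x => sq_nonneg _) hint]
  refine (Measure.mem_support_iff_forall l).1 hl _ ?_
  exact (hc.pow 2).continuousAt.eventually_ne (pow_ne_zero 2 hne)

lemma Matrix.mulVec_injective_of_rank_eq {T : ℕ} {D : Matrix (Fin T) (Fin T) ℝ}
    (hD : D.rank = T) : Function.Injective D.mulVec := by
  rw [Matrix.mulVec_injective_iff_isUnit, ← Matrix.mulVec_surjective_iff_isUnit]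
  have : LinearMap.range D.mulVecLin = ⊤ := 
    Submodule.eq_top_of_finrank_eq (hD.trans (Module.finrank_fin_fun ℝ).symm)
  exact LinearMap.range_eq_top.1 this

lemma countable_setOf_quadratic_eq {a : ℝ} (ha : a ≠ 0) (b c : ℝ) :
    {v : ℝ | a * v ^ 2 + b * v + c = 0}.Countable := by
  open Polynomial in
  have hp : (C a * X ^ 2 + C b * X + C c : ℝ[X]) ≠ 0 := fun h => ha <| by
    simpa [coeff_X, coeff_C] using congrArg (fun p => coeff p 2) h
  refine ((Polynomial.finite_setOfPred_isRoot hp).subset fun v hv => ?_).countable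
  simpa [Polynomial.IsRoot] using hv

lemma continuous_div_Icc (hε : 0 < ε) {b : ℝ≥0 → ℝ} (hb : Continuous b) :
    Continuous fun l : Set.Icc ε 1 => b (l : ℝ).toNNReal / (l : ℝ) :=
  (hb.comp (by fun_prop)).div₀ (by fun_prop) fun l => (hε.trans_le l.2.1).ne'

lemma continuous_quadraticPath_Icc {T : ℕ} (D : Matrix (Fin T) (Fin T) ℝ) (hε : 0 < ε)
    {b : Fin T → ℝ≥0 → ℝ} (hb : ∀ i, Continuous (b i)) :
    Continuous fun l : Set.Icc ε 1 => quadraticPath D b l := by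
  have h : Continuous fun l : Set.Icc ε 1 => fun i => b i (l : ℝ).toNNReal := by fun_prop
  unfold quadraticPath
  refine Continuous.mul ?_ (h.dotProduct (continuous_const.matrix_mulVec h))
  exact continuous_const.div₀ (by fun_prop) fun l => (pow_pos (hε.trans_le l.2.1) 2).ne'

lemma toNNReal_lt_one {l : Set.Icc ε 1} (hl : (l : ℝ) < 1) : (l : ℝ).toNNReal < 1 := by
  simpa using (Real.toNNReal_lt_toNNReal_iff zero_lt_one).2 hl

variable {Ω : Type*} [MeasurableSpace Ω] {P : Measure Ω} [IsProbabilityMeasure P]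

lemma ProbabilityTheory.IsBrownianReal.ae_pivotalDenominator_pos {B : ℝ≥0 → Ω → ℝ}
    (hB : IsBrownianReal B P) (hε : 0 < ε) (hν : ν {l | (l : ℝ) < 1} ≠ 0) :
    ∀ᵐ ω ∂P, 0 < pivotalDenominator ν fun t => B t ω := by
  obtain ⟨l, hl, hl1⟩ := exists_mem_support_lt_one hν
  have h := hB.isBrownianVector.ae_notMem_of_countable_sections (toNNReal_lt_one hl1) 0
    (S := {p | p.1 0 / (l : ℝ) = p.2 0}) (measurableSet_eq_fun (by fun_prop) (by fun_prop))
    fun a w => by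
      refine (Set.countable_singleton (a 0 / (l : ℝ))).mono fun v hv => ?_
      simpa [eq_comm] using hv
  filter_upwards [h, hB.cont] with ω hω hc
  exact Real.sqrt_pos.2 (integral_sq_pos_of_mem_support
    ((continuous_div_Icc hε hc).sub continuous_const) hl (sub_ne_zero.2 hω))

lemma IsBrownianVector.ae_quadraticDenominator_pos {T : ℕ} (hT : 0 < T)
    {B : Fin T → ℝ≥0 → Ω → ℝ} (hB : IsBrownianVector B P) (hε : 0 < ε)
    (hν : ν {l | (l : ℝ) < 1} ≠ 0) {D : Matrix (Fin T) (Fin T) ℝ} (hD : D.rank = T) :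
    ∀ᵐ ω ∂P, 0 < quadraticDenominator ν D fun i t => B i t ω := by
  obtain ⟨l, hl, hl1⟩ := exists_mem_support_lt_one hν
  set M := Dᵀ * D with hM
  let i₀ : Fin T := ⟨0, hT⟩
  let e : Fin T → ℝ := Pi.single i₀ 1
  -- This number is `‖D e‖²`, the leading coefficient of the quadratic polynomial below; it is
  -- nonzero since `D` is injective.
  have he : e ⬝ᵥ (M *ᵥ e) ≠ 0 := by
    rw [hM, ← Matrix.mulVec_mulVec, Matrix.dotProduct_mulVec, Matrix.vecMul_transpose]
    intro h0
    have h1 : D *ᵥ e = D *ᵥ 0 := by rw [Matrix.mulVec_zero]; exact dotProduct_self_eq_zero.1 h0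
    have := congrFun (Matrix.mulVec_injective_of_rank_eq hD h1) i₀
    simp [e] at this
  have hq : Continuous fun x : Fin T → ℝ => x ⬝ᵥ (M *ᵥ x) :=
    continuous_id.dotProduct (continuous_const.matrix_mulVec continuous_id)
  have h := hB.ae_notMem_of_countable_sections (toNNReal_lt_one hl1) i₀
    (S := {p | 1 / (l : ℝ) ^ 2 * (p.1 ⬝ᵥ (M *ᵥ p.1)) = p.2 ⬝ᵥ (M *ᵥ p.2)})
    (measurableSet_eq_fun ((hq.measurable.comp measurable_fst).const_mul _)
      (hq.measurable.comp measurable_snd))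
    fun a w => by
      -- Along `w₀ + v • e` the equation defining `S` is quadratic in `v`, so the section is
      -- countable.
      set w₀ := Function.update w i₀ 0
      have hupd (v : ℝ) : Function.update w i₀ v = w₀ + v • e := by
        ext i
        by_cases hi : i = i₀
        · subst hi; simp [w₀, e]
        · simp [w₀, e, hi]
      refine (countable_setOf_quadratic_eq he (w₀ ⬝ᵥ (M *ᵥ e) + e ⬝ᵥ (M *ᵥ w₀))
        (w₀ ⬝ᵥ (M *ᵥ w₀) - 1 / (l : ℝ) ^ 2 * (a ⬝ᵥ (M *ᵥ a)))).mono fun v hv => ?_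
      simp only [Set.mem_ofPred_eq, hupd, Matrix.mulVec_add, Matrix.mulVec_smul, dotProduct_add,
        add_dotProduct, smul_dotProduct, dotProduct_smul, smul_eq_mul] at hv ⊢
      linarith
  filter_upwards [h, hB.ae_continuous] with ω hω hc
  refine Real.sqrt_pos.2 (integral_sq_pos_of_mem_support
    ((continuous_quadraticPath_Icc D hε hc).sub continuous_const) hl (sub_ne_zero.2 ?_))
  simpa [quadraticPath] using hω

/-- Symmetry: `-B` is a Brownian motion with the same denominator, so a constant ratio `c` would
also equal `-c`. Then `B 1 = 0` almost surely, contradicting its Gaussian law. -/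
lemma ProbabilityTheory.IsBrownianReal.not_ae_eq_const {B : ℝ≥0 → Ω → ℝ}
    (hB : IsBrownianReal B P) (hε : 0 < ε) (hε1 : ε ≤ 1) (hν : ν {l | (l : ℝ) < 1} ≠ 0) (c : ℝ) :
    ¬ ∀ᵐ ω ∂P, B 1 ω / pivotalDenominator ν (fun t => B t ω) = c := by
  intro h
  have hneg : ∀ᵐ ω ∂P, (-B) 1 ω / pivotalDenominator ν (fun t => (-B) t ω) = c :=
    (hB.identDistrib_div_pivotalDenominator hB.neg hε hε1 ν).ae_snd
      (measurableSet_singleton c) h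
  have h0 : ∀ᵐ ω ∂P, B 1 ω = 0 := by
    filter_upwards [h, hneg, hB.ae_pivotalDenominator_pos hε hν] with ω h1 h2 h3
    have h4 : pivotalDenominator ν (fun t => (-B) t ω) = pivotalDenominator ν fun t => B t ω := by
      unfold pivotalDenominator
      congr 2 with l
      simp only [Pi.neg_apply]
      ring
    rw [h4, Pi.neg_apply, Pi.neg_apply, ← h1, neg_div, neg_eq_iff_add_eq_zero, ← two_mul,
      mul_eq_zero, div_eq_zero_iff] at h2
    simpa [h3.ne'] using h2
  have hlaw := hB.hasLaw_eval 1
  have hna := nullSingletonClass_gaussianReal (μ := 0) (v := 1) one_ne_zero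
  have h1 : P.map (B 1) {0} = 1 := by
    rw [Measure.map_apply_of_aemeasurable hlaw.aemeasurable (measurableSet_singleton 0)]
    exact (mem_ae_iff_prob_eq_one₀
      (hlaw.aemeasurable.nullMeasurable (measurableSet_singleton 0))).1 h0
  rw [hlaw.map_eq, measure_singleton] at h1
  exact zero_ne_one h1

end Positivity

/-! ### Exact expansion of the self-normalized statistic. -/

section SelfNormalizedStatistic

variable {T : ℕ} {ε : ℝ} {ν : Measure (Set.Icc ε 1)}

/-- Scale invariance of self-normalization: it removes the factors `(s ^ 2 * T)⁻¹` and `2 / (s * T)`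
from the statistic and `σ` from the limit. -/
lemma div_sqrt_integral_sq_const_mul (h : Set.Icc ε 1 → ℝ) (A : ℝ) {κ : ℝ} (hκ : 0 < κ) :
    κ * A / √(∫ l, (κ * h l) ^ 2 ∂ν) = A / √(∫ l, h l ^ 2 ∂ν) := by
  simp_rw [mul_pow]
  rw [integral_const_mul, Real.sqrt_mul (sq_nonneg κ), Real.sqrt_sq hκ.le,
    mul_div_mul_left _ _ hκ.ne']

variable [IsFiniteMeasure ν]

lemma measurable_selfNormalizedStat {Ω : Type*} [MeasurableSpace Ω] (hε1 : ε ≤ 1)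
    (β : EuclideanSpace ℝ (Fin T)) {b : Ω → Set.Icc ε 1 → EuclideanSpace ℝ (Fin T)}
    (hb : Measurable fun p : Ω × Set.Icc ε 1 => b p.1 p.2) :
    Measurable fun ω => selfNormalizedStat hε1 ν β (b ω) := by
  have h1 : Measurable fun ω => rms (b ω (rightEnd hε1)) :=
    (hb.comp (measurable_id.prodMk measurable_const)).norm.div_const _
  have h2 : Measurable fun p : Ω × Set.Icc ε 1 =>
      (rms (b p.1 p.2) ^ 2 - rms (b p.1 (rightEnd hε1)) ^ 2) ^ 2 :=
    (((hb.norm.div_const _).pow_const 2).sub ((h1.comp measurable_fst).pow_const 2)).pow_const 2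
  exact ((h1.pow_const 2).sub_const _).div
    h2.stronglyMeasurable.integral_prod_right'.measurable.sqrt

lemma rms_sq (b : EuclideanSpace ℝ (Fin T)) : rms b ^ 2 = ‖b‖ ^ 2 / T := by
  rw [rms, div_pow, Real.sq_sqrt T.cast_nonneg]

omit [IsFiniteMeasure ν] in
lemma selfNormalizedStat_zero_eq (hT : 0 < T) (hε1 : ε ≤ 1)
    {b x : Set.Icc ε 1 → EuclideanSpace ℝ (Fin T)} {s : ℝ} (hs : 0 < s)
    (hx : ∀ l, x l = s • (b l - 0)) :
    selfNormalizedStat hε1 ν 0 b = ‖x (rightEnd hε1)‖ ^ 2 /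
      √(∫ l, (‖x l‖ ^ 2 - ‖x (rightEnd hε1)‖ ^ 2) ^ 2 ∂ν) := by
  have hT' : (0 : ℝ) < T := by exact_mod_cast hT
  have h : ∀ l, rms (b l) ^ 2 = (s ^ 2 * T)⁻¹ * ‖x l‖ ^ 2 := fun l => by
    rw [rms_sq, hx, sub_zero, norm_smul, mul_pow, Real.norm_of_nonneg hs.le]
    field_simp
  rw [selfNormalizedStat, selfNormalizer, ← div_sqrt_integral_sq_const_mul
    (fun l => ‖x l‖ ^ 2 - ‖x (rightEnd hε1)‖ ^ 2) _ (κ := (s ^ 2 * T)⁻¹) (by positivity)]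
  simp_rw [h, mul_sub, rms_sq]
  simp

/-- The ratio of a number and a square root. -/
noncomputable def divSqrt (p : ℝ × ℝ) : ℝ := p.1 / √p.2

omit [IsFiniteMeasure ν] in
lemma selfNormalizedStat_zero_eq_divSqrt (hT : 0 < T) (hε1 : ε ≤ 1)
    {b x : Set.Icc ε 1 → EuclideanSpace ℝ (Fin T)} {s : ℝ} (hs : 0 < s)
    (hx : ∀ l, x l = s • (b l - 0)) (hxm : Measurable x) :
    selfNormalizedStat hε1 ν 0 b = divSqrt (‖x (rightEnd hε1)‖ ^ 2,
      pathFunctional ν (rightEnd hε1) (fun p => (‖p.1‖ ^ 2 - ‖p.2‖ ^ 2) ^ 2) x) := by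
  have hm : Measurable fun l => (‖x l‖ ^ 2 - ‖x (rightEnd hε1)‖ ^ 2) ^ 2 :=
    ((hxm.norm.pow_const 2).sub_const _).pow_const 2
  have hp := pathFunctional_eq_integral (ν := ν) (a := rightEnd hε1) (x := x)
    (F := fun p => (‖p.1‖ ^ 2 - ‖p.2‖ ^ 2) ^ 2) (fun _ => sq_nonneg _) hm.aestronglyMeasurable
  rw [selfNormalizedStat_zero_eq hT hε1 hs hx, divSqrt, hp]

/-- The first order part of the increment of the squared norm at `β`. -/
noncomputable def linearPart (β : EuclideanSpace ℝ (Fin T))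
    (p : EuclideanSpace ℝ (Fin T) × EuclideanSpace ℝ (Fin T)) : ℝ :=
  inner ℝ β p.1 - inner ℝ β p.2

/-- The second order part of the increment of the squared norm. -/
noncomputable def quadraticPart
    (p : EuclideanSpace ℝ (Fin T) × EuclideanSpace ℝ (Fin T)) : ℝ :=
  (‖p.1‖ ^ 2 - ‖p.2‖ ^ 2) / 2

lemma continuous_linearPart (β : EuclideanSpace ℝ (Fin T)) : Continuous (linearPart β) := by
  unfold linearPart; fun_prop

lemma continuous_quadraticPart : Continuous (quadraticPart (T := T)) := by
  unfold quadraticPart; fun_prop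

omit [IsFiniteMeasure ν] in
lemma selfNormalizedStat_eq (hT : 0 < T) (hε1 : ε ≤ 1) (β : EuclideanSpace ℝ (Fin T))
    {b x : Set.Icc ε 1 → EuclideanSpace ℝ (Fin T)} {s : ℝ} (hs : 0 < s)
    (hx : ∀ l, x l = s • (b l - β)) :
    selfNormalizedStat hε1 ν β b =
      (inner ℝ β (x (rightEnd hε1)) + s⁻¹ * (‖x (rightEnd hε1)‖ ^ 2 / 2)) /
      √(∫ l, (linearPart β (x l, x (rightEnd hε1)) +
        s⁻¹ * quadraticPart (x l, x (rightEnd hε1))) ^ 2 ∂ν) := by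
  have hT' : (0 : ℝ) < T := by exact_mod_cast hT
  have h : ∀ l, rms (b l) ^ 2 =
      rms β ^ 2 + 2 / (s * T) * (inner ℝ β (x l) + s⁻¹ * (‖x l‖ ^ 2 / 2)) := fun l => by
    have hb : b l = β + s⁻¹ • x l := by
      rw [hx, smul_smul, inv_mul_cancel₀ hs.ne', one_smul, add_sub_cancel]
    rw [rms_sq, rms_sq, hb, norm_add_sq_real, norm_smul, real_inner_smul_right, mul_pow,
      Real.norm_of_nonneg (by positivity)]
    field_simp
    ring
  rw [selfNormalizedStat, selfNormalizer, ← div_sqrt_integral_sq_const_mul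
    (fun l => linearPart β (x l, x (rightEnd hε1)) +
        s⁻¹ * quadraticPart (x l, x (rightEnd hε1))) _ (κ := 2 / (s * T)) (by positivity)]
  simp_rw [h, linearPart, quadraticPart]
  congr 1
  · ring
  · congr 2 with l
    ring

/-- The cross term `2 ∫ u v` is written by polarization, so that only integrals of squares occur;
`pathFunctional`, a lower integral, represents only nonnegative integrands faithfully. -/
lemma integral_add_const_mul_sq {u v : Set.Icc ε 1 → ℝ} (hu : Measurable u) (hv : Measurable v)
    {C : ℝ} (hu' : ∀ l, |u l| ≤ C) (hv' : ∀ l, |v l| ≤ C) (r : ℝ) :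
    ∫ l, (u l + r * v l) ^ 2 ∂ν = ∫ l, u l ^ 2 ∂ν +
      r * (∫ l, (u l + v l) ^ 2 ∂ν - ∫ l, u l ^ 2 ∂ν - ∫ l, v l ^ 2 ∂ν) +
      r ^ 2 * ∫ l, v l ^ 2 ∂ν := by
  have hu2 : Integrable (fun l => u l ^ 2) ν :=
    .of_bound (hu.pow_const 2).aestronglyMeasurable (C ^ 2) (ae_of_all _ fun l => by
      rw [norm_pow, Real.norm_eq_abs]; gcongr; exact hu' l)
  have hv2 : Integrable (fun l => v l ^ 2) ν :=
    .of_bound (hv.pow_const 2).aestronglyMeasurable (C ^ 2) (ae_of_all _ fun l => by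
      rw [norm_pow, Real.norm_eq_abs]; gcongr; exact hv' l)
  have huv : Integrable (fun l => u l * v l) ν :=
    .of_bound (hu.mul hv).aestronglyMeasurable (C * C) (ae_of_all _ fun l => by
      rw [norm_mul, Real.norm_eq_abs, Real.norm_eq_abs]
      exact mul_le_mul (hu' l) (hv' l) (abs_nonneg _) ((abs_nonneg _).trans (hu' l)))
  have key (r : ℝ) : ∫ l, (u l + r * v l) ^ 2 ∂ν =
      ∫ l, u l ^ 2 ∂ν + 2 * r * ∫ l, u l * v l ∂ν + r ^ 2 * ∫ l, v l ^ 2 ∂ν := by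
    rw [← integral_const_mul, ← integral_const_mul, ← integral_add hu2 (huv.const_mul _),
      ← integral_add (f := fun l => u l ^ 2 + 2 * r * (u l * v l)) (hu2.add (huv.const_mul _))
        (hv2.const_mul _)]
    congr with l
    ring
  have h1 := key 1
  simp only [one_mul, one_pow, mul_one] at h1
  rw [key, h1]
  ring

lemma exists_bound_comp_path {V : Type*} [NormedAddCommGroup V] [ProperSpace V]
    {F : V × V → ℝ} (hF : Continuous F) {x : Set.Icc ε 1 → V} {R : ℝ} (hx : ∀ l, ‖x l‖ ≤ R)
    (a : Set.Icc ε 1) : ∃ C, ∀ l, |F (x l, x a)| ≤ C := by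
  obtain ⟨C, hC⟩ := (isCompact_closedBall (0 : V × V) R).exists_bound_of_continuousOn
    hF.continuousOn
  refine ⟨C, fun l => hC _ ?_⟩
  simp [Prod.norm_def, hx]

/-- The value of the statistic in terms of finitely many functionals of the path of errors, as a
function of these functionals and of `n ^ (-1/2)`. -/
noncomputable def expandedStat (p : (ℝ × ℝ × ℝ × ℝ × ℝ) × ℝ) : ℝ :=
  (p.1.1 + p.2 * p.1.2.1) / √(p.1.2.2.1 +
    p.2 * (p.1.2.2.2.1 - p.1.2.2.1 - p.1.2.2.2.2) + p.2 ^ 2 * p.1.2.2.2.2)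

lemma selfNormalizedStat_eq_expandedStat (hT : 0 < T) (hε1 : ε ≤ 1)
    (β : EuclideanSpace ℝ (Fin T)) {b x : Set.Icc ε 1 → EuclideanSpace ℝ (Fin T)} {s : ℝ}
    (hs : 0 < s) (hx : ∀ l, x l = s • (b l - β)) (hxm : Measurable x) {R : ℝ}
    (hR : ∀ l, ‖x l‖ ≤ R) :
    selfNormalizedStat hε1 ν β b =
      expandedStat ((inner ℝ β (x (rightEnd hε1)), ‖x (rightEnd hε1)‖ ^ 2 / 2,
        pathFunctional ν (rightEnd hε1) (fun p => linearPart β p ^ 2) x,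
        pathFunctional ν (rightEnd hε1) (fun p => (linearPart β p + quadraticPart p) ^ 2) x,
        pathFunctional ν (rightEnd hε1) (fun p => quadraticPart p ^ 2) x), s⁻¹) := by
  have hpath : Measurable fun l => (x l, x (rightEnd hε1)) := hxm.prodMk measurable_const
  have hu := (continuous_linearPart β).measurable.comp hpath
  have hv := continuous_quadraticPart.measurable.comp hpath
  obtain ⟨C₁, hC₁⟩ := exists_bound_comp_path (continuous_linearPart β) hR (rightEnd hε1)
  obtain ⟨C₂, hC₂⟩ := exists_bound_comp_path continuous_quadraticPart hR (rightEnd hε1)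
  have hexp := integral_add_const_mul_sq (ν := ν) hu hv
    (fun l => (hC₁ l).trans (le_max_left C₁ C₂)) (fun l => (hC₂ l).trans (le_max_right C₁ C₂)) s⁻¹
  simp only [Function.comp_apply] at hexp
  rw [selfNormalizedStat_eq hT hε1 β hs hx, hexp]
  simp only [expandedStat]
  rw [pathFunctional_eq_integral (F := fun p => linearPart β p ^ 2) (fun _ => sq_nonneg _)
      (hu.pow_const 2).aestronglyMeasurable,
    pathFunctional_eq_integral (F := fun p => (linearPart β p + quadraticPart p) ^ 2)
      (fun _ => sq_nonneg _) ((hu.add hv).pow_const 2).aestronglyMeasurable,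
    pathFunctional_eq_integral (F := fun p => quadraticPart p ^ 2) (fun _ => sq_nonneg _)
      (hv.pow_const 2).aestronglyMeasurable]

/-! ### Values of the functionals at the limit process, and the two limit theorems. -/

variable {Ω : ℕ → Type*} [∀ n, MeasurableSpace (Ω n)]
  {P : ∀ n, Measure (Ω n)} [∀ n, IsProbabilityMeasure (P n)]
  {β : EuclideanSpace ℝ (Fin T)} {βhat : ∀ n, Ω n → Set.Icc ε 1 → EuclideanSpace ℝ (Fin T)}
  {D : Matrix (Fin T) (Fin T) ℝ} {Ω' : Type*} [MeasurableSpace Ω'] {P' : Measure Ω'}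
  [IsProbabilityMeasure P'] {B : Fin T → ℝ≥0 → Ω' → ℝ}

omit [IsFiniteMeasure ν] in
lemma continuous_scaledPath (hε : 0 < ε) (D : Matrix (Fin T) (Fin T) ℝ) {b : Fin T → ℝ≥0 → ℝ}
    (hb : ∀ i, Continuous (b i)) : Continuous fun l : Set.Icc ε 1 =>
      (l : ℝ)⁻¹ • WithLp.toLp 2 (D *ᵥ fun i => b i (l : ℝ).toNNReal) := by
  have h : Continuous fun l : Set.Icc ε 1 => fun i => b i (l : ℝ).toNNReal := by fun_prop
  refine Continuous.smul (Continuous.inv₀ (by fun_prop) fun l => (hε.trans_le l.2.1).ne') ?_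
  exact (PiLp.continuous_toLp 2 _).comp (continuous_const.matrix_mulVec h)

lemma norm_sq_scaledPath (D : Matrix (Fin T) (Fin T) ℝ) (b : Fin T → ℝ≥0 → ℝ) (l : ℝ) :
    ‖l⁻¹ • WithLp.toLp 2 (D *ᵥ fun i => b i l.toNNReal)‖ ^ 2 = quadraticPath D b l := by
  rw [norm_smul, mul_pow, Real.norm_eq_abs, sq_abs, EuclideanSpace.real_norm_sq_eq, quadraticPath,
    ← Matrix.mulVec_mulVec, Matrix.dotProduct_mulVec, Matrix.vecMul_transpose]
  simp [dotProduct, sq]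

lemma inner_scaledPath (β : EuclideanSpace ℝ (Fin T)) (D : Matrix (Fin T) (Fin T) ℝ)
    (b : Fin T → ℝ≥0 → ℝ) (l : ℝ) :
    inner ℝ β (l⁻¹ • WithLp.toLp 2 (D *ᵥ fun i => b i l.toNNReal)) =
      (∑ i, (Dᵀ *ᵥ β.ofLp) i * b i l.toNNReal) / l := by
  rw [real_inner_smul_right, EuclideanSpace.inner_eq_star_dotProduct, div_eq_inv_mul]
  congr 1
  change (D *ᵥ _) ⬝ᵥ star β.ofLp = _
  rw [star_trivial, dotProduct_comm, Matrix.dotProduct_mulVec, ← Matrix.mulVec_transpose]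
  rfl

omit [IsFiniteMeasure ν] in
lemma pathFunctional_norm_scaledPath (hε : 0 < ε) (hε1 : ε ≤ 1) (D : Matrix (Fin T) (Fin T) ℝ)
    {b : Fin T → ℝ≥0 → ℝ} (hb : ∀ i, Continuous (b i))
    {z : Set.Icc ε 1 → EuclideanSpace ℝ (Fin T)}
    (hz : ∀ l : Set.Icc ε 1,
      z l = (l : ℝ)⁻¹ • WithLp.toLp 2 (D *ᵥ fun i => b i (l : ℝ).toNNReal)) :
    ‖z (rightEnd hε1)‖ ^ 2 = quadraticPath D b 1 ∧
    pathFunctional ν (rightEnd hε1) (fun p => (‖p.1‖ ^ 2 - ‖p.2‖ ^ 2) ^ 2) z =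
      ∫ l : Set.Icc ε 1, (quadraticPath D b l - quadraticPath D b 1) ^ 2 ∂ν := by
  have hcont : Continuous z := by
    rw [funext hz]; exact continuous_scaledPath hε D hb
  have hn l : ‖z l‖ ^ 2 = quadraticPath D b l := by rw [hz, norm_sq_scaledPath]
  have h1 : ‖z (rightEnd hε1)‖ ^ 2 = quadraticPath D b 1 := by rw [hn]; rfl
  refine ⟨h1, ?_⟩
  rw [pathFunctional_eq_integral (F := fun p => (‖p.1‖ ^ 2 - ‖p.2‖ ^ 2) ^ 2)
    (fun _ => sq_nonneg _) (by fun_prop : Continuous fun l =>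
      (‖z l‖ ^ 2 - ‖z (rightEnd hε1)‖ ^ 2) ^ 2).measurable.aestronglyMeasurable]
  simp only [hn]
  rfl

omit [IsFiniteMeasure ν] in
lemma pathFunctional_inner_scaledPath (hε : 0 < ε) (hε1 : ε ≤ 1)
    (β : EuclideanSpace ℝ (Fin T)) (D : Matrix (Fin T) (Fin T) ℝ)
    {b : Fin T → ℝ≥0 → ℝ} (hb : ∀ i, Continuous (b i))
    {z : Set.Icc ε 1 → EuclideanSpace ℝ (Fin T)}
    (hz : ∀ l : Set.Icc ε 1,
      z l = (l : ℝ)⁻¹ • WithLp.toLp 2 (D *ᵥ fun i => b i (l : ℝ).toNNReal))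
    {w : ℝ≥0 → ℝ} {σ : ℝ} (hw : ∀ t, ∑ i, (Dᵀ *ᵥ β.ofLp) i * b i t = σ * w t) :
    inner ℝ β (z (rightEnd hε1)) = σ * w 1 ∧
    pathFunctional ν (rightEnd hε1) (fun p => linearPart β p ^ 2) z =
      ∫ l : Set.Icc ε 1, (σ * (w (l : ℝ).toNNReal / (l : ℝ) - w 1)) ^ 2 ∂ν := by
  have hcont : Continuous z := by
    rw [funext hz]; exact continuous_scaledPath hε D hb
  have hn l : inner ℝ β (z l) = σ * (w (l : ℝ).toNNReal / (l : ℝ)) := by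
    rw [hz, inner_scaledPath, hw, mul_div_assoc]
  have h1 : inner ℝ β (z (rightEnd hε1)) = σ * w 1 := by simp [hn, rightEnd]
  refine ⟨h1, ?_⟩
  rw [pathFunctional_eq_integral (F := fun p => linearPart β p ^ 2) (fun _ => sq_nonneg _)
    (((continuous_linearPart β).comp (hcont.prodMk continuous_const)).pow
      2).measurable.aestronglyMeasurable]
  simp only [linearPart, h1]
  simp only [hn, mul_sub]

theorem tendstoInDistribution_selfNormalizedStat_zero (hT : 0 < T) (hε : 0 < ε) (hε1 : ε ≤ 1)
    (hν : ν {l | (l : ℝ) < 1} ≠ 0)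
    (hβhat : ∀ n, Measurable fun p : Ω n × Set.Icc ε 1 => βhat n p.1 p.2) (hD : D.rank = T)
    (hB : IsBrownianVector B P') (hAN : SequentialAsymptoticNormality P βhat 0 D P' B) :
    TendstoInDistribution (fun n ω => selfNormalizedStat hε1 ν 0 (βhat n ω)) atTop
      (fun ω => quadraticPath D (fun i t => B i t ω) 1 /
        quadraticDenominator ν D fun i t => B i t ω) P P' := by
  obtain ⟨X, Z, hX, hZ, hw⟩ := hAN
  set a : Set.Icc ε 1 := rightEnd hε1
  let F (p : EuclideanSpace ℝ (Fin T) × EuclideanSpace ℝ (Fin T)) : ℝ :=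
    (‖p.1‖ ^ 2 - ‖p.2‖ ^ 2) ^ 2
  have hF : Continuous F := by fun_prop
  let Φ (x : BoundedPaths T ε) : ℝ × ℝ := (‖x a‖ ^ 2, pathFunctional ν a F x)
  have hΦ : Continuous Φ :=
    (((lp.evalCLM ℝ (fun _ : Set.Icc ε 1 => EuclideanSpace ℝ (Fin T)) ∞ a).continuous.norm).pow
      2).prodMk (continuous_pathFunctional ν a hF)
  have hXm n : Measurable fun p : Ω n × Set.Icc ε 1 => X n p.1 p.2 := by
    simp_rw [hX]
    exact ((hβhat n).sub_const _).const_smul √(n : ℝ)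
  have hΦm n : Measurable fun ω => Φ (X n ω) :=
    ((((hXm n).comp (measurable_id.prodMk measurable_const)).norm).pow_const 2).prodMk
      (measurable_pathFunctional hF.measurable (hXm n))
  have hG : Measurable divSqrt := by unfold divSqrt; fun_prop
  have hlim : ∀ᵐ ω ∂P', Φ (Z ω) = (quadraticPath D (fun i t => B i t ω) 1,
      ∫ l : Set.Icc ε 1, (quadraticPath D (fun i t => B i t ω) l -
        quadraticPath D (fun i t => B i t ω) 1) ^ 2 ∂ν) := by
    filter_upwards [hZ, hB.ae_continuous] with ω hω hc
    obtain ⟨h1, h2⟩ := pathFunctional_norm_scaledPath (ν := ν) hε hε1 D hc hω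
    exact Prod.ext h1 h2
  have hmain := (hw.tendstoInDistribution_comp hΦ hΦm).comp_of_ae_continuousAt hG (by
    filter_upwards [hlim, hB.ae_quadraticDenominator_pos hT hε hν hD] with ω h1 h2
    refine ContinuousAt.div₀ (by fun_prop) (by fun_prop) ?_
    rw [h1]
    exact h2.ne')
  have hlim' : (fun ω => divSqrt (Φ (Z ω))) =ᵐ[P'] fun ω =>
      quadraticPath D (fun i t => B i t ω) 1 / quadraticDenominator ν D fun i t => B i t ω := by
    filter_upwards [hlim] with ω h
    rw [h]
    rfl
  have hmain' := hmain.congr (fun _ => .rfl) hlim'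
  refine hmain'.congr_eventually
    (fun n => (measurable_selfNormalizedStat hε1 0 (hβhat n)).aemeasurable) ?_
  -- For `n = 0` the factor `√n` vanishes and `X n` does not determine the estimator; one index does
  -- not affect the limit.
  filter_upwards [eventually_gt_atTop 0] with n hn
  ext ω
  exact (selfNormalizedStat_zero_eq_divSqrt (ν := ν) hT hε1 (x := X n ω) (s := √n)
    (by positivity) (hX n ω) ((hXm n).comp measurable_prodMk_left)).symm

theorem tendstoInDistribution_selfNormalizedStat_of_ne_zero (hT : 0 < T) (hε : 0 < ε)
    (hε1 : ε ≤ 1) (hν : ν {l | (l : ℝ) < 1} ≠ 0) (hβ : β ≠ 0)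
    (hβhat : ∀ n, Measurable fun p : Ω n × Set.Icc ε 1 => βhat n p.1 p.2) (hD : D.rank = T)
    (hB : IsBrownianVector B P') (hAN : SequentialAsymptoticNormality P βhat β D P' B) :
    ∃ W : ℝ≥0 → Ω' → ℝ, IsBrownianReal W P' ∧
    TendstoInDistribution (fun n ω => selfNormalizedStat hε1 ν β (βhat n ω)) atTop
      (fun ω => W 1 ω / pivotalDenominator ν fun t => W t ω) P P' := by
  obtain ⟨X, Z, hX, hZ, hw⟩ := hAN
  set a : Set.Icc ε 1 := rightEnd hε1
  set d : Fin T → ℝ := Dᵀ *ᵥ β.ofLp with hd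
  -- Full rank of `D` passes to its transpose, so `D'β ≠ 0`; this is where `β ≠ 0` enters.
  have hd0 : d ≠ 0 := by
    intro h0
    have h1 := Matrix.mulVec_injective_of_rank_eq ((Matrix.rank_transpose D).trans hD)
      (h0.trans (Matrix.mulVec_zero Dᵀ).symm)
    exact hβ ((WithLp.ofLp_eq_zero 2).1 h1)
  set σ : ℝ := √(∑ i, d i ^ 2) with hσdef
  have hsum : 0 < ∑ i, d i ^ 2 := by
    obtain ⟨i, hi⟩ := Function.ne_iff.1 hd0
    exact Finset.sum_pos' (fun _ _ => sq_nonneg _) ⟨i, Finset.mem_univ i, by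
      have : d i ≠ 0 := hi
      positivity⟩
  have hσ : 0 < σ := Real.sqrt_pos.2 hsum
  let W (t : ℝ≥0) (ω : Ω') : ℝ := ∑ i, d i / σ * B i t ω
  have hW : IsBrownianReal W P' := by
    refine hB.isBrownianReal_sum ?_
    simp_rw [div_pow, ← Finset.sum_div]
    rw [hσdef, Real.sq_sqrt hsum.le, div_self hsum.ne']
  refine ⟨W, hW, ?_⟩
  let L (p : EuclideanSpace ℝ (Fin T) × EuclideanSpace ℝ (Fin T)) : ℝ := linearPart β p ^ 2
  let M (p : EuclideanSpace ℝ (Fin T) × EuclideanSpace ℝ (Fin T)) : ℝ :=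
    (linearPart β p + quadraticPart p) ^ 2
  let Q (p : EuclideanSpace ℝ (Fin T) × EuclideanSpace ℝ (Fin T)) : ℝ := quadraticPart p ^ 2
  have hL : Continuous L := (continuous_linearPart β).pow 2
  have hM : Continuous M := ((continuous_linearPart β).add continuous_quadraticPart).pow 2
  have hQ : Continuous Q := continuous_quadraticPart.pow 2
  let Φ (x : BoundedPaths T ε) : ℝ × ℝ × ℝ × ℝ × ℝ := (inner ℝ β (x a), ‖x a‖ ^ 2 / 2,
    pathFunctional ν a L x, pathFunctional ν a M x, pathFunctional ν a Q x)
  have heval := (lp.evalCLM ℝ (fun _ : Set.Icc ε 1 => EuclideanSpace ℝ (Fin T)) ∞ a).continuous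
  have hΦ : Continuous Φ :=
    (continuous_const.inner heval).prodMk <| ((heval.norm.pow 2).div_const 2).prodMk <|
      (continuous_pathFunctional ν a hL).prodMk <| (continuous_pathFunctional ν a hM).prodMk <|
      continuous_pathFunctional ν a hQ
  have hXm n : Measurable fun p : Ω n × Set.Icc ε 1 => X n p.1 p.2 := by
    simp_rw [hX]
    exact ((hβhat n).sub_const _).const_smul √(n : ℝ)
  have hXa n : Measurable fun ω => X n ω a :=
    (hXm n).comp (measurable_id.prodMk measurable_const)
  have hΦm n : Measurable fun ω => Φ (X n ω) :=
    (measurable_const.inner (hXa n)).prodMk <| (((hXa n).norm.pow_const 2).div_const 2).prodMk <|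
      (measurable_pathFunctional hL.measurable (hXm n)).prodMk <|
      (measurable_pathFunctional hM.measurable (hXm n)).prodMk <|
      measurable_pathFunctional hQ.measurable (hXm n)
  have hG : Measurable expandedStat := by unfold expandedStat; fun_prop
  have hlim : ∀ᵐ ω ∂P', inner ℝ β (Z ω a) = σ * W 1 ω ∧ pathFunctional ν a L (Z ω) =
      ∫ l : Set.Icc ε 1, (σ * (W (l : ℝ).toNNReal ω / (l : ℝ) - W 1 ω)) ^ 2 ∂ν := by
    filter_upwards [hZ, hB.ae_continuous] with ω hω hc
    refine pathFunctional_inner_scaledPath (ν := ν) hε hε1 β D hc hω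
      (w := fun t => W t ω) (σ := σ) fun t => ?_
    simp only [W, Finset.mul_sum]
    congr with i
    field_simp
    exact mul_comm _ _
  have hr : Tendsto (fun n : ℕ => (√(n : ℝ))⁻¹) atTop (𝓝 0) :=
    tendsto_inv_atTop_zero.comp (Real.tendsto_sqrt_atTop.comp tendsto_natCast_atTop_atTop)
  have hmain := ((hw.tendstoInDistribution_comp hΦ hΦm).prodMk_const_of_tendsto
    hr).comp_of_ae_continuousAt hG (by
      filter_upwards [hlim, hW.ae_pivotalDenominator_pos hε hν] with ω h1 h2
      -- At second component `0` the radicand of `expandedStat` reduces to `σ ^ 2` times the squared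
      -- pivotal denominator, which is almost surely positive.
      refine ContinuousAt.div₀ (by fun_prop) (by fun_prop) ?_
      have h3 := Real.sqrt_pos.1 h2
      simp only [Φ, h1.2, mul_pow]
      rw [integral_const_mul]
      simp only [zero_mul, add_zero, ne_eq, OfNat.ofNat_ne_zero, not_false_eq_true, zero_pow]
      positivity)
  have hlim' : (fun ω => expandedStat (Φ (Z ω), 0)) =ᵐ[P'] fun ω =>
      W 1 ω / pivotalDenominator ν fun t => W t ω := by
    filter_upwards [hlim] with ω h
    simp only [expandedStat, Φ, h.1, h.2, zero_mul, add_zero, ne_eq, OfNat.ofNat_ne_zero,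
      not_false_eq_true, zero_pow]
    exact div_sqrt_integral_sq_const_mul _ _ hσ
  have hmain' := hmain.congr (fun _ => .rfl) hlim'
  refine hmain'.congr_eventually
    (fun n => (measurable_selfNormalizedStat hε1 β (hβhat n)).aemeasurable) ?_
  filter_upwards [eventually_gt_atTop 0] with n hn
  ext ω
  exact (selfNormalizedStat_eq_expandedStat (ν := ν) hT hε1 β (x := X n ω) (s := √n) (by positivity)
    (hX n ω) ((hXm n).comp measurable_prodMk_left)
    (lp.norm_apply_le_norm ENNReal.top_ne_zero (X n ω))).symm

end SelfNormalizedStatistic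

theorem theorem2 {T : ℕ} (hT : 0 < T) {ε : ℝ} (hε : 0 < ε) (hε1 : ε ≤ 1)
    (ν : Measure (Set.Icc ε 1)) [IsFiniteMeasure ν] (hν : ν {l | (l : ℝ) < 1} ≠ 0)
    {Ω : ℕ → Type*} [∀ n, MeasurableSpace (Ω n)]
    (P : ∀ n, Measure (Ω n)) [∀ n, IsProbabilityMeasure (P n)]
    (β : EuclideanSpace ℝ (Fin T))
    (βhat : ∀ n, Ω n → Set.Icc ε 1 → EuclideanSpace ℝ (Fin T))
    (hβhat : ∀ n, Measurable (fun p : Ω n × Set.Icc ε 1 => βhat n p.1 p.2))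
    (D : Matrix (Fin T) (Fin T) ℝ) (hD : D.rank = T)
    {Ω' : Type*} [MeasurableSpace Ω'] (P' : Measure Ω') [IsProbabilityMeasure P']
    (B' : Fin T → ℝ≥0 → Ω' → ℝ) (hB' : IsBrownianVector B' P')
    (hAN : SequentialAsymptoticNormality P βhat β D P' B') :
    (β ≠ 0 →
      ∀ {Ω₁ : Type*} [MeasurableSpace Ω₁] (P₁ : Measure Ω₁) [IsProbabilityMeasure P₁]
        (B : ℝ≥0 → Ω₁ → ℝ), IsBrownianReal B P₁ →
        (∀ᵐ ω ∂P₁, 0 < pivotalDenominator ν (fun t => B t ω)) ∧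
        (∀ c : ℝ, ¬ ∀ᵐ ω ∂P₁, B 1 ω / pivotalDenominator ν (fun t => B t ω) = c) ∧
        TendstoInDistribution (fun n ω => selfNormalizedStat hε1 ν β (βhat n ω)) atTop
          (fun ω => B 1 ω / pivotalDenominator ν (fun t => B t ω)) P P₁) ∧
    (β = 0 →
      ∀ {Ω₂ : Type*} [MeasurableSpace Ω₂] (P₂ : Measure Ω₂) [IsProbabilityMeasure P₂]
        (B : Fin T → ℝ≥0 → Ω₂ → ℝ), IsBrownianVector B P₂ →
        (∀ᵐ ω ∂P₂, 0 < quadraticDenominator ν D (fun i t => B i t ω)) ∧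
        TendstoInDistribution (fun n ω => selfNormalizedStat hε1 ν β (βhat n ω)) atTop
          (fun ω => quadraticPath D (fun i t => B i t ω) 1 /
            quadraticDenominator ν D (fun i t => B i t ω)) P P₂) := by
  refine ⟨fun hβ Ω₁ _ P₁ _ B hB => ⟨hB.ae_pivotalDenominator_pos hε hν,
    hB.not_ae_eq_const hε hε1 hν, ?_⟩, fun hβ Ω₂ _ P₂ _ B hB =>
    ⟨hB.ae_quadraticDenominator_pos hT hε hν hD, ?_⟩⟩
  -- The limit is first obtained for the Brownian motion `W` built from `B'`, then carried over to
  -- `B` by equality of laws.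
  · obtain ⟨W, hW, h⟩ := tendstoInDistribution_selfNormalizedStat_of_ne_zero hT hε hε1 hν hβ hβhat
      hD hB' hAN
    exact h.congr_map (hW.identDistrib_div_pivotalDenominator hB hε hε1 ν)
  · subst hβ
    exact (tendstoInDistribution_selfNormalizedStat_zero hT hε hε1 hν hβhat hD hB' hAN).congr_map
      (hB'.identDistrib_div_quadraticDenominator hB hε hε1 ν D)
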